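/- Let $N\ge 1$, $[N]=\{1,\dots,N\}$, let $\mathcal H_1,\dots,\mathcal H_N$ be real Hilbert spaces and $\mathcal H=\mathcal H_1\oplus\cdots\oplus\mathcal H_N$ their Hilbert direct sum, with elements $x=(x_1,\dots,x_N)$. *Network.* Let $\mathcal G$ be a strongly connected directed graph on $[N]$, and let $A=(a_{ij})\in\mathbb R^{N\times N}$ be a row-stochastic matrix with $a_{ii}>0$ for all $i$ and, for $i\ne j$, $a_{ij}>0$ if and only if $(j,i)$ is an edge of $\mathcal G$. Let $\pi=(\pi_1,\dots,\pi_N)^\top$ be the stochastic left eigenvector of $A$ for the eigenvalue $1$ (so $\pi_i>0$, $\sum_i\pi_i=1$, $\pi^\top A=\pi^\top$), and put $A_\infty=\mathbf 1_N\pi^\top$ $(=\lim_{k\to\infty}A^k)$. *Operators.* For each $i\in[N]$ let $\mathtt F_i:\mathcal H\to\mathcal H_i$ be Lipschitz with constant $L_i$, and let $F=(\mathtt F_1,\dots,\mathtt F_N):\mathcal H\to\mathcal H$. Assume that $\mathrm{Fix}(F)=\{x: F(x)=x\}\neq\emptyset$, that $F$ is quasi-nonexpansive, i.e. $\|F(x)-y\|\le\|x-y\|$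 for all $x\in\mathcal H$ and $y\in \mathrm{Fix}(F)$, and that $F$ is linearly regular with constant $\kappa>0$, i.e. $\inf_{y\in \mathrm{Fix}(F)}\|x-y\|\le\kappa\|F(x)-x\|$ for all $x\in\mathcal H$. *Algorithm (DOP).* Given a step size $\alpha$ and arbitrary $x_0^1,\dots,x_0^N\in\mathcal H$, agent $i$ maintains an estimate $x_k^i=(x_{1,k}^i,\dots,x_{N,k}^i)\in\mathcal H$, and for $k\ge0$ and $i\in[N]$ $$x_{i,k+1}^i=\sum_{j=1}^N a_{ij}x_{i,k}^j+\frac{\alpha}{\pi_i}\Big(\mathtt F_i(x_k^i)-\sum_{j=1}^N a_{ij}x_{i,k}^j\Big),\qquad x_{l,k+1}^i=\sum_{j=1}^N a_{ij}x_{l,k}^j\quad(l\neq i).$$ *Constants.* For $z=(z_1,\dots,z_N)$ in $\mathcal H^N$ or $\mathbb R^N$ let $\|z\|=\big(\sum_i\|z_i\|^2\big)^{1/2}$ and $\|z\|_\pi=\big(\sum_i\pi_i\|z_i\|^2\big)^{1/2}$; for a real $N\times N$ matrix $M$ let $\|M\|_\pi$ be the norm induced by $\|\cdot\|_\pi$ on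 $\mathbb R^N$. Let $c_1,c_2>0$ satisfy $c_1\|z\|\le\|z\|_\pi\le c_2\|z\|$ for all $z\in\mathcal H^N$, let $\delta\in(0,1)$, and put $\rho_1=\|A-A_\infty\|_\pi$, $\bar L=\max_i L_i$, $\underline\pi=\min_i\pi_i$, $\varpi=N-1+\frac{(1-\underline\pi)^2}{\underline\pi^2}$, $\theta_5=\frac{2c_2\sqrt{\varpi(\bar L^2+1)}}{c_1}$, and $$\Theta(\alpha)=\begin{pmatrix}\rho_1+\alpha\theta_5 & 2\alpha c_2\sqrt{2\varpi}\\[2pt] \dfrac{\alpha(\bar L+1)}{c_1} & 1-\dfrac{\delta\alpha}{4\kappa^2}\end{pmatrix}.$$ **Theorem.** If $N\ge2$, the equation $\det(I-\Theta(\alpha))=0$ has a smallest positive real root $\alpha_L$; for $N=1$ it has no positive root, and we put $\alpha_L=+\infty$. If $$0<\alpha<\min\{1-\delta,\alpha_L\},$$ then all the estimates $x_k^i$ generated by DOP converge to a common point of $\mathrm{Fix}(F)$ at a linear rate: there is $r\in(0,1)$ such that for all initial points $x_0^1,\dots,x_0^N\in\mathcal H$ there are $x^\star\in \mathrm{Fix}(F)$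 and $C\ge0$ with $\|x_k^i-x^\star\|\le C\,r^k$ for all $k\ge0$ and all $i\in[N]$. -/

import Mathlib

namespace DOP

/-- Quasi-nonexpansive operator: `‖T x - T y‖ ≤ ‖x - y‖` for all `x` and all fixed points `y`. -/
def QuasiNonexpansive {E : Type*} [NormedAddCommGroup E] (T : E → E) : Prop :=
  ∀ x, ∀ y ∈ Function.fixedPoints T, ‖T x - T y‖ ≤ ‖x - y‖

/-- Linear regularity with constant `κ`: `d_{Fix T}(x) ≤ κ ‖T x - x‖` for all `x`. -/
def LinearlyRegular {E : Type*} [NormedAddCommGroup E] (T : E → E) (κ : ℝ) : Prop :=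
  ∀ x, Metric.infDist x (Function.fixedPoints T) ≤ κ * ‖T x - x‖

/-- A directed graph is strongly connected if any node can be reached from any node along
a directed path. -/
def StronglyConnected {V : Type*} (G : Digraph V) : Prop :=
  ∀ i j, Relation.ReflTransGen G.Adj i j

/-- The weight matrix `A` is compatible with the digraph `G`, in which `G.Adj j i` means that
agent `j` can send information to agent `i`: the diagonal is positive, and off the diagonal
`a_ij > 0` exactly for the edges `(j, i)`. -/
def CompatibleWith {V : Type*} (A : Matrix V V ℝ) (G : Digraph V) : Prop :=
  (∀ i, 0 < A i i) ∧ ∀ i j, i ≠ j → (0 < A i j ↔ G.Adj j i)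

/-- `w` is a stochastic left eigenvector of `A` for the eigenvalue `1`. -/
def IsLeftStochasticEigenvector {V : Type*} [Fintype V] (A : Matrix V V ℝ) (w : V → ℝ) : Prop :=
  (∀ i, 0 ≤ w i) ∧ ∑ i, w i = 1 ∧ Matrix.vecMul w A = w

/-- The natural norm `√(∑ ‖z_i‖²)` of a finite family. -/
noncomputable def naturalNorm {V E : Type*} [Fintype V] [NormedAddCommGroup E] (z : V → E) : ℝ :=
  √(∑ i, ‖z i‖ ^ 2)

/-- The weighted norm `‖z‖_w = √(∑ w_i ‖z_i‖²)` of a finite family. -/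
noncomputable def weightedNorm {V E : Type*} [Fintype V] [NormedAddCommGroup E]
    (w : V → ℝ) (z : V → E) : ℝ :=
  √(∑ i, w i * ‖z i‖ ^ 2)

/-- The matrix norm induced by the weighted norm on real vectors. -/
noncomputable def weightedOpNorm {V : Type*} [Fintype V] (w : V → ℝ) (M : Matrix V V ℝ) : ℝ :=
  ⨆ x : V → ℝ, weightedNorm w (M.mulVec x) / weightedNorm w x

/-- The rank-one matrix `1 wᵀ`, all of whose rows are `w`. -/
def onesOuter {V : Type*} (w : V → ℝ) : Matrix V V ℝ := Matrix.vecMulVec 1 w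

section Block

variable {N : ℕ} {H : Fin N → Type*} [∀ i, NormedAddCommGroup (H i)]
  [∀ i, InnerProductSpace ℝ (H i)]

/-- The global operator `F = (F_1, …, F_N)` on the Hilbert sum. -/
def blockOperator (F : ∀ i, PiLp 2 H → H i) : PiLp 2 H → PiLp 2 H :=
  fun x => WithLp.toLp 2 fun i => F i x

/-- `x k i l` is the estimate at time `k` by agent `i` of the block of agent `l`; in particular
`x k i i` is agent `i`'s own block. The sequence `x` is generated by the algorithm with step size
`α`, weight matrix `A` and local operators `F i`, from an arbitrary `x 0`. -/
structure IsDOPSequence (A : Matrix (Fin N) (Fin N) ℝ) (w : Fin N → ℝ)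
    (F : ∀ i, PiLp 2 H → H i) (α : ℝ) (x : ℕ → Fin N → PiLp 2 H) : Prop where
  own_block : ∀ k i, x (k + 1) i i =
    ∑ j, A i j • x k j i + (α / w i) • (F i (x k i) - ∑ j, A i j • x k j i)
  other_blocks : ∀ k i l, l ≠ i → x (k + 1) i l = ∑ j, A i j • x k j l

end Block

/-- `ϖ = N - 1 + (1 - m)² / m²` with `m = min_i w_i`. -/
noncomputable def varpi {N : ℕ} (w : Fin N → ℝ) : ℝ :=
  (N : ℝ) - 1 + (1 - ⨅ i, w i) ^ 2 / (⨅ i, w i) ^ 2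

/-- The matrix `Θ(α)`; here `ρ₁ = ‖A - 1 wᵀ‖_w`, `Lbar = max_i L_i` and
`θ₅ = 2 c₂ √(ϖ (Lbar² + 1)) / c₁`. -/
noncomputable def Theta {N : ℕ} (A : Matrix (Fin N) (Fin N) ℝ) (w L : Fin N → ℝ)
    (c₁ c₂ δ κ α : ℝ) : Matrix (Fin 2) (Fin 2) ℝ :=
  let ρ₁ := weightedOpNorm w (A - onesOuter w)
  let Lbar := ⨆ i, L i
  let θ₅ := 2 * c₂ * √(varpi w * (Lbar ^ 2 + 1)) / c₁
  !![ρ₁ + α * θ₅, 2 * α * c₂ * √(2 * varpi w);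
     α * (Lbar + 1) / c₁, 1 - δ * α / (4 * κ ^ 2)]

/-- The positive real roots of `det (I - Θ(a)) = 0`. -/
def positiveRoots {N : ℕ} (A : Matrix (Fin N) (Fin N) ℝ) (w L : Fin N → ℝ)
    (c₁ c₂ δ κ : ℝ) : Set ℝ :=
  {a | 0 < a ∧ (1 - Theta A w L c₁ c₂ δ κ a).det = 0}

end DOP

/-! Split the estimates into their `w`-weighted mean x̄ and the deviations Z from it. Since wᵀA = wᵀ
and the factor 1/w_i cancels the weight of agent i, the mean follows an inexact relaxation x̄ ↦ x̄ +
α(F(x̄) - x̄) + α·error, with error O(‖Z‖) by Lipschitz continuity (`norm_residualError_le`).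
Quasi-nonexpansiveness and linear regularity make the exact step shrink the distance d from x̄ to
Fix(F) (`infDist_relaxation_le`). The deviations are contracted by `A - onesOuter w`, whose weighted
norm is below 1 by connectivity (`weightedOpNorm_sub_onesOuter_lt_one`), up to α times a
perturbation controlled by ‖Z‖ and d.

So (‖Z‖, d) is dominated entrywise by Θ(α). As det(I - Θ(α)) is α times an affine function of α that
is positive at 0, α < α_L keeps it positive, and a positive vector strictly decreased by Θ(α) gives
geometric decay (`exists_rate_of_two_by_two`). The means are then Cauchy, with limit in the closed
set Fix(F). -/

namespace DOP

/-! ### Perron vector and strict contraction by connectivity -/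

section Network

variable {V : Type*} [Fintype V] {A : Matrix V V ℝ} {w : V → ℝ}

theorem IsLeftStochasticEigenvector.sum_mul (hw : IsLeftStochasticEigenvector A w) (j : V) :
    ∑ i, w i * A i j = w j :=
  congrFun hw.2.2 j

variable [DecidableEq V]

/-- Some weight is positive because the sum is 1, and wᵀA = wᵀ carries positivity backwards along
edges. -/
theorem IsLeftStochasticEigenvector.pos {G : Digraph V} (hG : StronglyConnected G)
    (hA : A ∈ Matrix.rowStochastic ℝ V) (hAG : CompatibleWith A G)
    (hw : IsLeftStochasticEigenvector A w) (i : V) : 0 < w i := by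
  obtain ⟨i₀, -, hi₀⟩ : ∃ i ∈ Finset.univ, 0 < w i := by
    refine Finset.exists_lt_of_sum_lt (f := fun _ => (0 : ℝ)) ?_
    simp [hw.2.1]
  refine Relation.ReflTransGen.head_induction_on (motive := fun j _ => 0 < w j) (hG i i₀) hi₀ ?_
  intro j i hji _ hi
  have hij : 0 < A i j := by
    rcases eq_or_ne i j with rfl | hne
    · exact hAG.1 i
    · exact (hAG.2 i j hne).2 hji
  rw [← hw.sum_mul j]
  exact Finset.sum_pos' (fun l _ => mul_nonneg (hw.1 l) (Matrix.nonneg_of_mem_rowStochastic hA))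
    ⟨i, Finset.mem_univ i, mul_pos hi hij⟩

/-- Decomposition of the weighted square sum into the contribution of `A - 1 wᵀ`, the square of
the mean and the local variances. -/
theorem sum_sq_decomposition (hA : A ∈ Matrix.rowStochastic ℝ V)
    (hw : IsLeftStochasticEigenvector A w) (x : V → ℝ) :
    ∑ i, w i * x i ^ 2 = ∑ i, w i * ((A - onesOuter w).mulVec x i) ^ 2 + (∑ i, w i * x i) ^ 2 +
      ∑ i, w i * ∑ j, A i j * (x j - A.mulVec x i) ^ 2 := by
  have hM : ∀ i, (A - onesOuter w).mulVec x i = A.mulVec x i - ∑ j, w j * x j := by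
    intro i
    simp [onesOuter, Matrix.vecMulVec, Matrix.mulVec, dotProduct, sub_mul]
  have hmean : ∑ i, w i * A.mulVec x i = ∑ j, w j * x j := by
    change w ⬝ᵥ A.mulVec x = w ⬝ᵥ x
    rw [Matrix.dotProduct_mulVec, hw.2.2]
  have hrow : ∀ i, ∑ j, A i j = 1 := fun i => Matrix.sum_row_of_mem_rowStochastic hA i
  have hvar : ∀ i, ∑ j, A i j * (x j - A.mulVec x i) ^ 2 =
      ∑ j, A i j * x j ^ 2 - A.mulVec x i ^ 2 := by
    intro i
    have h : A.mulVec x i = ∑ j, A i j * x j := rfl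
    calc ∑ j, A i j * (x j - A.mulVec x i) ^ 2
        = ∑ j, A i j * x j ^ 2 - 2 * A.mulVec x i * ∑ j, A i j * x j
          + (∑ j, A i j) * A.mulVec x i ^ 2 := by
          rw [Finset.mul_sum, Finset.sum_mul, ← Finset.sum_sub_distrib, ← Finset.sum_add_distrib]
          exact Finset.sum_congr rfl fun j _ => by ring
      _ = _ := by rw [← h, hrow]; ring
  have hsq : ∑ i, w i * ∑ j, A i j * x j ^ 2 = ∑ j, w j * x j ^ 2 := by
    simp_rw [Finset.mul_sum]
    rw [Finset.sum_comm]
    refine Finset.sum_congr rfl fun j _ => ?_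
    rw [← hw.sum_mul j, Finset.sum_mul]
    exact Finset.sum_congr rfl fun i _ => by ring
  set c := ∑ j, w j * x j with hc
  have h1 : ∑ i, w i * (A.mulVec x i - c) ^ 2 =
      ∑ i, w i * A.mulVec x i ^ 2 - 2 * c * ∑ i, w i * A.mulVec x i + (∑ i, w i) * c ^ 2 := by
    rw [Finset.mul_sum, Finset.sum_mul, ← Finset.sum_sub_distrib, ← Finset.sum_add_distrib]
    exact Finset.sum_congr rfl fun j _ => by ring
  simp_rw [hM, hvar, mul_sub, Finset.sum_sub_distrib]
  rw [h1, hsq, hmean, hw.2.1]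
  ring

/-- Otherwise the mean and all local variances in `sum_sq_decomposition` vanish. As `A i i > 0`,
zero variance at i equates x_i with x_j for every in-neighbour j, so x is constant by connectivity,
hence zero. -/
theorem sum_sq_mulVec_lt {G : Digraph V} (hG : StronglyConnected G)
    (hA : A ∈ Matrix.rowStochastic ℝ V) (hAG : CompatibleWith A G)
    (hw : IsLeftStochasticEigenvector A w) {x : V → ℝ} (hx : x ≠ 0) :
    ∑ i, w i * ((A - onesOuter w).mulVec x i) ^ 2 < ∑ i, w i * x i ^ 2 := by
  have hpos := hw.pos hG hA hAG
  have hA0 : ∀ i j, 0 ≤ A i j := fun i j => Matrix.nonneg_of_mem_rowStochastic hA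
  by_contra! hle
  have hdec := sum_sq_decomposition hA hw x
  have hin : ∀ i, 0 ≤ ∑ j, A i j * (x j - A.mulVec x i) ^ 2 := fun i =>
    Finset.sum_nonneg fun j _ => mul_nonneg (hA0 i j) (sq_nonneg _)
  have hV : 0 ≤ ∑ i, w i * ∑ j, A i j * (x j - A.mulVec x i) ^ 2 :=
    Finset.sum_nonneg fun i _ => mul_nonneg (hpos i).le (hin i)
  have hmean : ∑ i, w i * x i = 0 := by
    have := sq_nonneg (∑ i, w i * x i)
    exact pow_eq_zero_iff two_ne_zero |>.1 (by linarith)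
  have hV0 : ∑ i, w i * ∑ j, A i j * (x j - A.mulVec x i) ^ 2 = 0 := by
    have := sq_nonneg (∑ i, w i * x i)
    linarith
  have hloc : ∀ i j, 0 < A i j → x j = A.mulVec x i := by
    intro i j hij
    have h1 := (Finset.sum_eq_zero_iff_of_nonneg
      (fun i _ => mul_nonneg (hpos i).le (hin i))).1 hV0 i (Finset.mem_univ i)
    have h2 := (mul_eq_zero.1 h1).resolve_left (hpos i).ne'
    have h3 := (Finset.sum_eq_zero_iff_of_nonneg
      (fun j _ => mul_nonneg (hA0 i j) (sq_nonneg _))).1 h2 j (Finset.mem_univ j)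
    have h4 := (mul_eq_zero.1 h3).resolve_left hij.ne'
    exact sub_eq_zero.1 (pow_eq_zero_iff two_ne_zero |>.1 h4)
  have hadj : ∀ i j, G.Adj j i → x j = x i := by
    intro i j hji
    rcases eq_or_ne i j with rfl | hne
    · rfl
    · rw [hloc i j ((hAG.2 i j hne).2 hji), hloc i i (hAG.1 i)]
  have hconst : ∀ i j, x j = x i := by
    intro i j
    induction hG j i with
    | refl => rfl
    | tail _ h ih => exact ih.trans (hadj _ _ h)
  refine hx (funext fun i => ?_)
  have : ∑ j, w j * x j = x i := by
    simp_rw [hconst i, ← Finset.sum_mul, hw.2.1, one_mul]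
  rw [← this, hmean, Pi.zero_apply]

end Network

/-! ### Natural and weighted norms of families -/

section WeightedNorm

variable {V E : Type*} [Fintype V] [NormedAddCommGroup E] {w : V → ℝ}

theorem naturalNorm_eq_norm (z : V → E) : naturalNorm z = ‖WithLp.toLp 2 z‖ := by
  simp [naturalNorm, PiLp.norm_eq_of_L2]

theorem weightedNorm_nonneg (w : V → ℝ) (z : V → E) : 0 ≤ weightedNorm w z := Real.sqrt_nonneg _

theorem weightedNorm_sq (hw : ∀ i, 0 ≤ w i) (z : V → E) :
    weightedNorm w z ^ 2 = ∑ i, w i * ‖z i‖ ^ 2 :=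
  Real.sq_sqrt (Finset.sum_nonneg fun i _ => mul_nonneg (hw i) (sq_nonneg _))

theorem weightedNorm_eq_norm [NormedSpace ℝ E] (hw : ∀ i, 0 ≤ w i) (z : V → E) :
    weightedNorm w z = ‖WithLp.toLp 2 fun i => √(w i) • z i‖ := by
  simp [weightedNorm, PiLp.norm_eq_of_L2, norm_smul, mul_pow, Real.sq_sqrt, hw]

theorem weightedNorm_add_le [NormedSpace ℝ E] (hw : ∀ i, 0 ≤ w i) (y z : V → E) :
    weightedNorm w (y + z) ≤ weightedNorm w y + weightedNorm w z := by
  simp_rw [weightedNorm_eq_norm hw]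
  refine le_of_eq_of_le (congrArg _ ?_) (norm_add_le _ _)
  ext i
  simp

theorem weightedNorm_smul [NormedSpace ℝ E] (hw : ∀ i, 0 ≤ w i) (c : ℝ) (z : V → E) :
    weightedNorm w (c • z) = |c| * weightedNorm w z := by
  simp_rw [weightedNorm_eq_norm hw]
  rw [← Real.norm_eq_abs, ← norm_smul]
  congr 1
  ext i
  simp [smul_comm c]

theorem norm_le_naturalNorm (z : V → E) (i : V) : ‖z i‖ ≤ naturalNorm z := by
  rw [naturalNorm_eq_norm]
  exact PiLp.norm_apply_le (WithLp.toLp 2 z) i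

theorem naturalNorm_sq (z : V → E) : naturalNorm z ^ 2 = ∑ i, ‖z i‖ ^ 2 :=
  Real.sq_sqrt (Finset.sum_nonneg fun _ _ => sq_nonneg _)

end WeightedNorm

/-! ### The induced matrix norm, for real and Hilbert-valued families -/

section WeightedOpNorm

variable {V : Type*} [Fintype V] {w : V → ℝ}

theorem weightedNorm_pos (hw : ∀ i, 0 < w i) {x : V → ℝ} (hx : x ≠ 0) : 0 < weightedNorm w x := by
  obtain ⟨i, hi⟩ := Function.ne_iff.1 hx
  refine Real.sqrt_pos.2 (Finset.sum_pos' (fun _ _ => mul_nonneg (hw _).le (sq_nonneg _))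
    ⟨i, Finset.mem_univ i, mul_pos (hw i) (by simpa [sq_pos_iff] using hi)⟩)

theorem continuous_weightedNorm (w : V → ℝ) :
    Continuous (weightedNorm w : (V → ℝ) → ℝ) := by
  unfold weightedNorm
  fun_prop

/-- The ratio is scale invariant, so a maximum over the compact unit sphere is global. Attainment
turns a pointwise strict inequality into a strict norm bound. -/
theorem exists_weightedNorm_mulVec_ratio_max [Nonempty V] (hw : ∀ i, 0 < w i) (M : Matrix V V ℝ) :
    ∃ x₀ : V → ℝ, x₀ ≠ 0 ∧ ∀ x, weightedNorm w (M.mulVec x) / weightedNorm w x ≤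
      weightedNorm w (M.mulVec x₀) / weightedNorm w x₀ := by
  have hne : ∀ x ∈ Metric.sphere (0 : V → ℝ) 1, x ≠ 0 := by
    rintro x hx rfl
    simp at hx
  obtain ⟨x₀, hx₀, hmax⟩ := (isCompact_sphere (0 : V → ℝ) 1).exists_isMaxOn
    (NormedSpace.sphere_nonempty.2 zero_le_one)
    (f := fun x => weightedNorm w (M.mulVec x) / weightedNorm w x)
    (ContinuousOn.div
      ((continuous_weightedNorm w).comp (by fun_prop : Continuous M.mulVec)).continuousOn
      (continuous_weightedNorm w).continuousOn
      fun x hx => (weightedNorm_pos hw (hne x hx)).ne')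
  refine ⟨x₀, hne x₀ hx₀, fun x => ?_⟩
  -- The supremum defining `weightedOpNorm` includes x = 0, where the ratio 0 / 0 is 0.
  rcases eq_or_ne x 0 with rfl | hx
  · have : weightedNorm w (0 : V → ℝ) = 0 := by simp [weightedNorm]
    rw [this, div_zero]
    exact div_nonneg (weightedNorm_nonneg _ _) (weightedNorm_nonneg _ _)
  · have hx' : ‖x‖ ≠ 0 := norm_ne_zero_iff.2 hx
    have h := hmax (a := ‖x‖⁻¹ • x) (by simp [norm_smul, hx'])
    have hw0 : ∀ i, 0 ≤ w i := fun i => (hw i).le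
    simp only [Set.mem_ofPred_eq, Matrix.mulVec_smul, weightedNorm_smul hw0] at h
    rwa [mul_div_mul_left _ _ (by simpa using hx')] at h

theorem weightedOpNorm_nonneg (w : V → ℝ) (M : Matrix V V ℝ) : 0 ≤ weightedOpNorm w M :=
  Real.iSup_nonneg fun _ => div_nonneg (weightedNorm_nonneg _ _) (weightedNorm_nonneg _ _)

theorem weightedNorm_mulVec_le [Nonempty V] (hw : ∀ i, 0 < w i) (M : Matrix V V ℝ) (x : V → ℝ) :
    weightedNorm w (M.mulVec x) ≤ weightedOpNorm w M * weightedNorm w x := by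
  obtain ⟨x₀, -, hmax⟩ := exists_weightedNorm_mulVec_ratio_max hw M
  rcases eq_or_ne x 0 with rfl | hx
  · simp [weightedNorm]
  · rw [← div_le_iff₀ (weightedNorm_pos hw hx)]
    exact le_ciSup (f := fun x => weightedNorm w (M.mulVec x) / weightedNorm w x)
      ⟨_, Set.forall_mem_range.2 hmax⟩ x

section Hilbert

variable {E : Type*} [NormedAddCommGroup E] [InnerProductSpace ℝ E]

/-- The matrix of the quadratic form `c ‖x‖_w² - ‖M x‖_w²`. -/
noncomputable def weightedGapMatrix [DecidableEq V] (w : V → ℝ) (M : Matrix V V ℝ) (c : ℝ) :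
    Matrix V V ℝ :=
  Matrix.of fun j k => c * (if j = k then w j else 0) - ∑ i, w i * (M i j * M i k)

theorem sum_weightedGapMatrix_mul_inner [DecidableEq V] (hw : ∀ i, 0 ≤ w i) (M : Matrix V V ℝ)
    (c : ℝ) (z : V → E) :
    ∑ j, ∑ k, weightedGapMatrix w M c j k * inner ℝ (z j) (z k) =
      c * weightedNorm w z ^ 2 - weightedNorm w (fun i => ∑ j, M i j • z j) ^ 2 := by
  rw [weightedNorm_sq hw, weightedNorm_sq hw]
  simp_rw [← real_inner_self_eq_norm_sq, sum_inner, inner_sum, real_inner_smul_left,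
    real_inner_smul_right, weightedGapMatrix, Matrix.of_apply, sub_mul, Finset.sum_sub_distrib]
  congr 1
  · simp [Finset.mul_sum, mul_assoc]
  · simp_rw [Finset.mul_sum, Finset.sum_mul]
    conv_rhs => rw [Finset.sum_comm]
    refine Finset.sum_congr rfl fun j _ => ?_
    conv_rhs => rw [Finset.sum_comm]
    exact Finset.sum_congr rfl fun k _ => Finset.sum_congr rfl fun i _ => by ring

/-- A positive semidefinite real matrix acts nonnegatively on Hilbert-space valued families. -/
theorem sum_posSemidef_mul_inner_nonneg {B : Matrix V V ℝ} (hB : B.PosSemidef) (z : V → E) :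
    0 ≤ ∑ j, ∑ k, B j k * inner ℝ (z j) (z k) := by
  classical
  obtain ⟨m, v, rfl⟩ := Matrix.posSemidef_iff_eq_sum_vecMulVec.1 hB
  have : ∑ j, ∑ k, (∑ i, Matrix.vecMulVec (v i) (star (v i))) j k * inner ℝ (z j) (z k) =
      ∑ i, ‖∑ j, v i j • z j‖ ^ 2 := by
    simp_rw [← real_inner_self_eq_norm_sq, sum_inner, inner_sum, real_inner_smul_left,
      real_inner_smul_right, Matrix.sum_apply, Matrix.vecMulVec_apply, Pi.star_apply, star_trivial,
      Finset.sum_mul]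
    conv_rhs => rw [Finset.sum_comm]
    refine Finset.sum_congr rfl fun j _ => ?_
    conv_rhs => rw [Finset.sum_comm]
    exact Finset.sum_congr rfl fun k _ => Finset.sum_congr rfl fun i _ => by ring
  rw [this]
  exact Finset.sum_nonneg fun i _ => sq_nonneg _

/-- The bound by the induced norm carries over from real to Hilbert-space valued families. -/
theorem weightedNorm_sum_smul_le [Nonempty V] (hw : ∀ i, 0 < w i) (M : Matrix V V ℝ) (z : V → E) :
    weightedNorm w (fun i => ∑ j, M i j • z j) ≤ weightedOpNorm w M * weightedNorm w z := by
  classical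
  have hw0 : ∀ i, 0 ≤ w i := fun i => (hw i).le
  have hρ := weightedOpNorm_nonneg w M
  -- Semidefiniteness is the real-valued bound itself; a sum of rank-one squares then transfers it
  -- to Hilbert-valued families.
  have hB : (weightedGapMatrix w M (weightedOpNorm w M ^ 2)).PosSemidef := by
    refine Matrix.PosSemidef.of_dotProduct_mulVec_nonneg ?_ fun x => ?_
    · ext j k
      simp only [weightedGapMatrix, Matrix.conjTranspose_apply, Matrix.of_apply, star_trivial]
      congr 1
      · rcases eq_or_ne j k with rfl | h
        · rfl
        · simp [h, h.symm]
      · exact Finset.sum_congr rfl fun i _ => by ring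
    · have h := sum_weightedGapMatrix_mul_inner hw0 M (weightedOpNorm w M ^ 2) x
      have hM : (fun i => ∑ j, M i j • x j) = M.mulVec x := rfl
      have hle := pow_le_pow_left₀ (weightedNorm_nonneg _ _) (weightedNorm_mulVec_le hw M x) 2
      rw [hM] at h
      have h0 : 0 ≤ ∑ j, ∑ k, weightedGapMatrix w M (weightedOpNorm w M ^ 2) j k *
          inner ℝ (x j) (x k) := by
        rw [h]
        linarith [mul_pow (weightedOpNorm w M) (weightedNorm w x) 2]
      refine h0.trans_eq ?_
      simp only [dotProduct, Matrix.mulVec, Finset.mul_sum, Pi.star_apply, star_trivial,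
        RCLike.inner_apply, conj_trivial]
      exact Finset.sum_congr rfl fun j _ => Finset.sum_congr rfl fun k _ => by ring
  have h := sum_posSemidef_mul_inner_nonneg hB z
  rw [sum_weightedGapMatrix_mul_inner hw0] at h
  refine le_of_sq_le_sq ?_ (mul_nonneg hρ (weightedNorm_nonneg _ _))
  rw [mul_pow]
  linarith

end Hilbert

theorem weightedOpNorm_sub_onesOuter_lt_one [DecidableEq V] [Nonempty V] {A : Matrix V V ℝ}
    {G : Digraph V} (hG : StronglyConnected G)
    (hA : A ∈ Matrix.rowStochastic ℝ V) (hAG : CompatibleWith A G)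
    (hw : IsLeftStochasticEigenvector A w) : weightedOpNorm w (A - onesOuter w) < 1 := by
  have hpos := hw.pos hG hA hAG
  obtain ⟨x₀, hx₀, hmax⟩ := exists_weightedNorm_mulVec_ratio_max hpos (A - onesOuter w)
  refine (ciSup_le hmax).trans_lt ?_
  rw [div_lt_one (weightedNorm_pos hpos hx₀)]
  refine Real.sqrt_lt_sqrt (Finset.sum_nonneg fun i _ =>
    mul_nonneg (hpos i).le (sq_nonneg _)) ?_
  simpa using sum_sq_mulVec_lt hG hA hAG hw hx₀

end WeightedOpNorm

/-! ### Relaxed steps of a linearly regular quasi-nonexpansive operator -/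

section Operator

variable {E : Type*} [NormedAddCommGroup E] {T : E → E} {κ : ℝ}

theorem QuasiNonexpansive.norm_sub_le_two_mul_infDist (hT : QuasiNonexpansive T)
    (hne : (Function.fixedPoints T).Nonempty) (x : E) :
    ‖T x - x‖ ≤ 2 * Metric.infDist x (Function.fixedPoints T) := by
  have : ‖T x - x‖ / 2 ≤ Metric.infDist x (Function.fixedPoints T) := by
    refine (Metric.le_infDist hne).2 fun {y} hy => ?_
    have h1 := hT x y hy
    rw [hy.eq] at h1
    have h2 := norm_sub_le_norm_sub_add_norm_sub (T x) y x
    rw [norm_sub_rev y x] at h2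
    rw [dist_eq_norm]
    linarith
  linarith

variable [InnerProductSpace ℝ E]

/-- Expanding ‖T x - y‖² ≤ ‖x - y‖² gives 2⟨x - y, T x - x⟩ ≤ -‖T x - x‖², which bounds the cross
term. -/
theorem norm_relaxation_sq_le (hT : QuasiNonexpansive T) {α : ℝ} (hα : 0 ≤ α) (x : E) {y : E}
    (hy : y ∈ Function.fixedPoints T) :
    ‖x + α • (T x - x) - y‖ ^ 2 ≤ ‖x - y‖ ^ 2 - α * (1 - α) * ‖T x - x‖ ^ 2 := by
  have h1 := hT x y hy
  rw [hy.eq] at h1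
  have h2 := pow_le_pow_left₀ (norm_nonneg _) h1 2
  have e1 : T x - y = (x - y) + (T x - x) := by abel
  have e2 : x + α • (T x - x) - y = (x - y) + α • (T x - x) := by abel
  rw [e1, norm_add_sq_real] at h2
  rw [e2, norm_add_sq_real, real_inner_smul_right, norm_smul, mul_pow, Real.norm_eq_abs, sq_abs]
  nlinarith

/-- A relaxed step decreases the squared distance to the fixed point set. -/
theorem infDist_relaxation_sq_le (hT : QuasiNonexpansive T)
    (hne : (Function.fixedPoints T).Nonempty) (hκ : 0 < κ) (hreg : LinearlyRegular T κ)
    {α δ : ℝ} (hα : 0 < α) (hδ : 0 < δ) (hαδ : α < 1 - δ) (x : E) :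
    Metric.infDist (x + α • (T x - x)) (Function.fixedPoints T) ^ 2 ≤
      (1 - δ * α / κ ^ 2) * Metric.infDist x (Function.fixedPoints T) ^ 2 := by
  set d := Metric.infDist x (Function.fixedPoints T)
  set d' := Metric.infDist (x + α • (T x - x)) (Function.fixedPoints T)
  have hd0 : 0 ≤ d := Metric.infDist_nonneg
  have hd'0 : 0 ≤ d' := Metric.infDist_nonneg
  have hb : d ^ 2 / κ ^ 2 ≤ ‖T x - x‖ ^ 2 := by
    rw [div_le_iff₀ (by positivity), ← mul_pow, mul_comm]
    exact pow_le_pow_left₀ hd0 (hreg x) 2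
  have hgain : δ * α * (d ^ 2 / κ ^ 2) ≤ α * (1 - α) * ‖T x - x‖ ^ 2 := by
    refine mul_le_mul ?_ hb (by positivity) ?_
    · nlinarith
    · nlinarith
  -- The left side is a lower bound for every distance from x to a fixed point, so no nearest point
  -- is needed.
  have hs : √(d' ^ 2 + δ * α * (d ^ 2 / κ ^ 2)) ≤ d := by
    refine (Metric.le_infDist hne).2 fun {y} hy => ?_
    refine Real.sqrt_le_iff.2 ⟨dist_nonneg, ?_⟩
    have h1 := norm_relaxation_sq_le hT hα.le x hy
    have h2 : d' ^ 2 ≤ ‖x + α • (T x - x) - y‖ ^ 2 := by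
      refine pow_le_pow_left₀ hd'0 ?_ 2
      rw [← dist_eq_norm]
      exact Metric.infDist_le_dist_of_mem hy
    rw [dist_eq_norm]
    linarith
  have := (Real.sqrt_le_iff.1 hs).2
  calc d' ^ 2 ≤ d ^ 2 - δ * α * (d ^ 2 / κ ^ 2) := by linarith
    _ = _ := by ring

/-- A larger gap would make a square negative. This makes the entry 1 - δα/(4κ²) nonnegative
whenever the distance is nonzero. -/
theorem regularity_gap_le_one (hT : QuasiNonexpansive T)
    (hne : (Function.fixedPoints T).Nonempty) (hκ : 0 < κ) (hreg : LinearlyRegular T κ)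
    {α δ : ℝ} (hα : 0 < α) (hδ : 0 < δ) (hαδ : α < 1 - δ) {x : E}
    (hx : Metric.infDist x (Function.fixedPoints T) ≠ 0) : δ * α / κ ^ 2 ≤ 1 := by
  have h := infDist_relaxation_sq_le hT hne hκ hreg hα hδ hαδ x
  have hpos : 0 < Metric.infDist x (Function.fixedPoints T) ^ 2 := by positivity
  by_contra! hlt
  nlinarith [sq_nonneg (Metric.infDist (x + α • (T x - x)) (Function.fixedPoints T))]

theorem infDist_relaxation_le (hT : QuasiNonexpansive T)
    (hne : (Function.fixedPoints T).Nonempty) (hκ : 0 < κ) (hreg : LinearlyRegular T κ)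
    {α δ : ℝ} (hα : 0 < α) (hδ : 0 < δ) (hαδ : α < 1 - δ) (x : E) :
    Metric.infDist (x + α • (T x - x)) (Function.fixedPoints T) ≤
      (1 - δ * α / (4 * κ ^ 2)) * Metric.infDist x (Function.fixedPoints T) := by
  have h := infDist_relaxation_sq_le hT hne hκ hreg hα hδ hαδ x
  rcases eq_or_ne (Metric.infDist x (Function.fixedPoints T)) 0 with h0 | h0
  · rw [h0] at h ⊢
    rw [mul_zero]
    refine (pow_eq_zero_iff two_ne_zero).1 (le_antisymm ?_ (sq_nonneg _)) |>.le
    simpa using h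
  · have ht := regularity_gap_le_one hT hne hκ hreg hα hδ hαδ h0
    have hpos : 0 ≤ δ * α / κ ^ 2 := by positivity
    have e : δ * α / (4 * κ ^ 2) = δ * α / κ ^ 2 / 4 := by field_simp
    rw [e]
    set t := δ * α / κ ^ 2
    have hd : 0 ≤ Metric.infDist x (Function.fixedPoints T) := Metric.infDist_nonneg
    refine le_of_sq_le_sq (h.trans ?_) (mul_nonneg (by linarith) hd)
    rw [mul_pow]
    refine mul_le_mul_of_nonneg_right ?_ (sq_nonneg _)
    -- 1 - t ≤ (1 - t/4)² for t ≥ 0; t ≤ 1 served only to keep 1 - t/4 nonnegative.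
    nlinarith

end Operator

/-! ### Geometric decay for two-dimensional linear inequalities -/

/-- A nonnegative pair of sequences dominated by a `2 × 2` linear system whose spectral radius is
below one decays geometrically. -/
theorem exists_rate_of_two_by_two {p q s m : ℝ} (hq : 0 ≤ q) (hs : 0 ≤ s)
    (hp0 : 0 ≤ p) (hm : m < 1) (hdet : q * s < (1 - p) * (1 - m)) :
    ∃ r ∈ Set.Ioo (0 : ℝ) 1, ∀ e d : ℕ → ℝ, (∀ k, 0 ≤ e k) → (∀ k, 0 ≤ d k) →
      (∀ k, d k = 0 ∨ 0 ≤ m) → (∀ k, e (k + 1) ≤ p * e k + q * d k) →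
      (∀ k, d (k + 1) ≤ s * e k + m * d k) →
      ∃ C, 0 ≤ C ∧ ∀ k, e k ≤ C * r ^ k ∧ d k ≤ C * r ^ k := by
  obtain ⟨u, v, hu, hv, h1, h2⟩ : ∃ u v : ℝ, 0 < u ∧ 0 < v ∧ p * u + q * v < u ∧
      s * u + m * v < v := by
    -- For (u, v) = (1 - m, s + ε) the two inequalities reduce to qε < (q + 1)ε and mε < ε.
    set ε := ((1 - p) * (1 - m) - q * s) / (q + 1) with hε
    have hε0 : 0 < ε := div_pos (by linarith) (by linarith)
    have hεe : (q + 1) * ε = (1 - p) * (1 - m) - q * s := by rw [hε]; field_simp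
    refine ⟨1 - m, s + ε, by linarith, by linarith, by nlinarith, by nlinarith⟩
  -- The 1/2 keeps r positive: the other two ratios need not be.
  set r := max (1 / 2) (max ((p * u + q * v) / u) ((s * u + m * v) / v)) with hr
  have hr0 : 0 < r := lt_max_of_lt_left (by norm_num)
  have hr1 : r < 1 := by
    refine max_lt (by norm_num) (max_lt ?_ ?_)
    · rwa [div_lt_one hu]
    · rwa [div_lt_one hv]
  have hru : p * u + q * v ≤ r * u := by
    rw [← div_le_iff₀ hu]
    exact (le_max_left _ _).trans (le_max_right _ _)
  have hrv : s * u + m * v ≤ r * v := by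
    rw [← div_le_iff₀ hv]
    exact (le_max_right _ _).trans (le_max_right _ _)
  refine ⟨r, ⟨hr0, hr1⟩, fun e d he hd hdm hes hds => ?_⟩
  set K := e 0 / u + d 0 / v with hK
  have hK0 : 0 ≤ K := add_nonneg (div_nonneg (he 0) hu.le) (div_nonneg (hd 0) hv.le)
  have main : ∀ k, e k ≤ K * r ^ k * u ∧ d k ≤ K * r ^ k * v := by
    intro k
    induction k with
    | zero =>
      rw [pow_zero, mul_one, ← div_le_iff₀ hu, ← div_le_iff₀ hv, hK]
      exact ⟨le_add_of_nonneg_right (div_nonneg (hd 0) hv.le),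
        le_add_of_nonneg_left (div_nonneg (he 0) hu.le)⟩
    | succ k ih =>
      have hKr : 0 ≤ K * r ^ k := by positivity
      constructor
      · calc e (k + 1) ≤ p * e k + q * d k := hes k
          _ ≤ p * (K * r ^ k * u) + q * (K * r ^ k * v) :=
            add_le_add (mul_le_mul_of_nonneg_left ih.1 hp0) (mul_le_mul_of_nonneg_left ih.2 hq)
          _ = K * r ^ k * (p * u + q * v) := by ring
          _ ≤ K * r ^ k * (r * u) := mul_le_mul_of_nonneg_left hru hKr
          _ = _ := by ring
      -- Multiplying the bound on `d k` by m needs m ≥ 0; if that fails, `d (k + 1)` is zero anyway.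
      · rcases hdm (k + 1) with h0 | hm0
        · rw [h0]
          positivity
        · calc d (k + 1) ≤ s * e k + m * d k := hds k
            _ ≤ s * (K * r ^ k * u) + m * (K * r ^ k * v) :=
              add_le_add (mul_le_mul_of_nonneg_left ih.1 hs) (mul_le_mul_of_nonneg_left ih.2 hm0)
            _ = K * r ^ k * (s * u + m * v) := by ring
            _ ≤ K * r ^ k * (r * v) := mul_le_mul_of_nonneg_left hrv hKr
            _ = _ := by ring
  refine ⟨K * (u + v), by positivity, fun k => ?_⟩
  have hKr : 0 ≤ K * r ^ k := by positivity
  constructor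
  · nlinarith [(main k).1]
  · nlinarith [(main k).2]

/-! ### Mean and deviation recursions -/

section Iteration

variable {N : ℕ} {H : Fin N → Type*} [∀ i, NormedAddCommGroup (H i)]
  [∀ i, InnerProductSpace ℝ (H i)]

/-- The weighted average of the estimates. -/
noncomputable def weightedMean (w : Fin N → ℝ) (X : Fin N → PiLp 2 H) : PiLp 2 H :=
  ∑ i, w i • X i

/-- The deviations of the estimates from their weighted average. -/
noncomputable def deviation (w : Fin N → ℝ) (X : Fin N → PiLp 2 H) : Fin N → PiLp 2 H :=
  fun i => X i - weightedMean w X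

/-- The residual `F_l(x^l) - (A x)^l_l` whose multiple corrects the own block of agent `l`. -/
noncomputable def ownResidual (A : Matrix (Fin N) (Fin N) ℝ) (F : ∀ i, PiLp 2 H → H i)
    (X : Fin N → PiLp 2 H) : PiLp 2 H :=
  WithLp.toLp 2 fun l => F l (X l) - ∑ j, A l j • X j l

/-- The contribution of the own-block corrections to the deviations, up to the step size. -/
noncomputable def ownPerturbation (w : Fin N → ℝ) (g : PiLp 2 H) : Fin N → PiLp 2 H :=
  fun i => WithLp.toLp 2 fun l => ((if l = i then (w l)⁻¹ else 0) - 1 : ℝ) • g l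

/-- One step of the algorithm, from the estimates `X` to the estimates `Y`. -/
structure IsDOPStep (A : Matrix (Fin N) (Fin N) ℝ) (w : Fin N → ℝ)
    (F : ∀ i, PiLp 2 H → H i) (α : ℝ) (X Y : Fin N → PiLp 2 H) : Prop where
  own_block : ∀ i, Y i i = ∑ j, A i j • X j i + (α / w i) • (F i (X i) - ∑ j, A i j • X j i)
  other_blocks : ∀ i l, l ≠ i → Y i l = ∑ j, A i j • X j l

theorem IsDOPSequence.step {A : Matrix (Fin N) (Fin N) ℝ} {w : Fin N → ℝ}
    {F : ∀ i, PiLp 2 H → H i} {α : ℝ} {x : ℕ → Fin N → PiLp 2 H}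
    (hx : IsDOPSequence A w F α x) (k : ℕ) : IsDOPStep A w F α (x k) (x (k + 1)) :=
  ⟨hx.own_block k, hx.other_blocks k⟩

variable {A : Matrix (Fin N) (Fin N) ℝ} {w : Fin N → ℝ} {F : ∀ i, PiLp 2 H → H i} {α : ℝ}
  {X Y : Fin N → PiLp 2 H}

theorem sum_smul_apply (c : Fin N → ℝ) (X : Fin N → PiLp 2 H) (l : Fin N) :
    (∑ j, c j • X j) l = ∑ j, c j • X j l := by
  simp

theorem IsDOPStep.apply (h : IsDOPStep A w F α X Y) (i l : Fin N) :
    Y i l = ∑ j, A i j • X j l +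
      (if l = i then α * (w l)⁻¹ else 0 : ℝ) • ownResidual A F X l := by
  rcases eq_or_ne l i with rfl | hl
  · simp [h.own_block, ownResidual, div_eq_mul_inv]
  · simp [h.other_blocks i l hl, hl]

theorem IsDOPStep.weightedMean_eq (h : IsDOPStep A w F α X Y)
    (hw : IsLeftStochasticEigenvector A w) (hpos : ∀ i, 0 < w i) :
    weightedMean w Y = weightedMean w X + α • ownResidual A F X := by
  ext l
  simp only [weightedMean, PiLp.add_apply, PiLp.smul_apply, sum_smul_apply, h.apply, smul_add,
    Finset.sum_add_distrib, Finset.smul_sum, smul_smul]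
  congr 1
  · rw [Finset.sum_comm]
    simp_rw [← Finset.sum_smul, hw.sum_mul]
  · rw [Finset.sum_eq_single l]
    · rw [if_pos rfl, mul_left_comm, mul_inv_cancel₀ (hpos l).ne', mul_one]
    · intro i _ hi
      simp [hi.symm]
    · simp

theorem sum_smul_deviation (hw : ∑ i, w i = 1) (X : Fin N → PiLp 2 H) :
    ∑ i, w i • deviation w X i = 0 := by
  simp [deviation, smul_sub, ← Finset.sum_smul, hw, weightedMean]

theorem sum_row_smul_deviation (hA : A ∈ Matrix.rowStochastic ℝ (Fin N)) (X : Fin N → PiLp 2 H)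
    (i : Fin N) : ∑ j, A i j • deviation w X j = ∑ j, A i j • X j - weightedMean w X := by
  simp [deviation, smul_sub, ← Finset.sum_smul, Matrix.sum_row_of_mem_rowStochastic hA]

/-- Deviations have weighted mean zero, so the rank-one part annihilates them and the contractive
matrix may replace A. -/
theorem sum_sub_onesOuter_smul_deviation (hw : ∑ i, w i = 1) (X : Fin N → PiLp 2 H) (i : Fin N) :
    ∑ j, (A - onesOuter w) i j • deviation w X j = ∑ j, A i j • deviation w X j := by
  simp [onesOuter, Matrix.vecMulVec, sub_smul, sum_smul_deviation hw]

theorem IsDOPStep.deviation_eq (h : IsDOPStep A w F α X Y)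
    (hA : A ∈ Matrix.rowStochastic ℝ (Fin N))
    (hw : IsLeftStochasticEigenvector A w) (hpos : ∀ i, 0 < w i) :
    deviation w Y = (fun i => ∑ j, (A - onesOuter w) i j • deviation w X j) +
      α • ownPerturbation w (ownResidual A F X) := by
  funext i
  simp only [Pi.add_apply, Pi.smul_apply]
  rw [sum_sub_onesOuter_smul_deviation hw.2.1, sum_row_smul_deviation hA]
  ext l
  simp only [deviation, h.weightedMean_eq hw hpos, PiLp.sub_apply, PiLp.add_apply, PiLp.smul_apply,
    h.apply, sum_smul_apply, ownPerturbation]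
  rcases eq_or_ne l i with rfl | hl
  · simp only [if_true]
    module
  · simp only [hl, if_false]
    module

theorem varpi_nonneg [NeZero N] (w : Fin N → ℝ) : 0 ≤ varpi w := by
  have : (1 : ℝ) ≤ N := by exact_mod_cast NeZero.one_le
  exact add_nonneg (by linarith) (by positivity)

theorem varpi_pos (hN : 2 ≤ N) (w : Fin N → ℝ) : 0 < varpi w := by
  have : (2 : ℝ) ≤ N := by exact_mod_cast hN
  exact add_pos_of_pos_of_nonneg (by linarith) (by positivity)

theorem inv_sub_one_sq_le [NeZero N] (hpos : ∀ i, 0 < w i) (hsum : ∑ i, w i = 1) (l : Fin N) :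
    ((w l)⁻¹ - 1) ^ 2 ≤ (1 - ⨅ i, w i) ^ 2 / (⨅ i, w i) ^ 2 := by
  obtain ⟨i₀, hi₀⟩ := exists_eq_ciInf_of_finite (f := w)
  have hle : ⨅ i, w i ≤ w l := ciInf_le (Set.finite_range w).bddBelow l
  have hm : 0 < ⨅ i, w i := hi₀ ▸ hpos i₀
  have h1 : w l ≤ 1 := hsum ▸ Finset.single_le_sum (fun i _ => (hpos i).le) (Finset.mem_univ l)
  rw [← div_pow, sub_div, div_self hm.ne', one_div]
  exact pow_le_pow_left₀ (sub_nonneg.2 ((one_le_inv₀ (hpos l)).2 h1))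
    (sub_le_sub_right (inv_anti₀ hm hle) 1) 2

/-- Block l is scaled by -1 at N - 1 agents and by 1/w_l - 1 at agent l; the squares sum to at most
ϖ. -/
theorem naturalNorm_ownPerturbation_le [NeZero N] (hpos : ∀ i, 0 < w i) (hsum : ∑ i, w i = 1)
    (g : PiLp 2 H) : naturalNorm (ownPerturbation w g) ≤ √(varpi w) * ‖g‖ := by
  refine le_of_sq_le_sq ?_ (by positivity)
  rw [naturalNorm_sq, mul_pow, Real.sq_sqrt (varpi_nonneg w), PiLp.norm_sq_eq_of_L2,
    Finset.mul_sum]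
  simp_rw [PiLp.norm_sq_eq_of_L2]
  rw [Finset.sum_comm]
  refine Finset.sum_le_sum fun l _ => ?_
  simp only [ownPerturbation, norm_smul, mul_pow, Real.norm_eq_abs, sq_abs, ← Finset.sum_mul]
  refine mul_le_mul_of_nonneg_right ?_ (sq_nonneg _)
  have hsplit : ∑ i, ((if l = i then (w l)⁻¹ else 0) - 1 : ℝ) ^ 2 =
      ((N : ℝ) - 1) + ((w l)⁻¹ - 1) ^ 2 := by
    have : ∀ i, ((if l = i then (w l)⁻¹ else 0) - 1 : ℝ) ^ 2 =
        (if l = i then ((w l)⁻¹ - 1) ^ 2 - 1 else 0) + 1 := by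
      intro i
      split_ifs <;> ring
    simp only [this, Finset.sum_add_distrib, Finset.sum_ite_eq, Finset.mem_univ, if_true,
      Finset.sum_const, Finset.card_univ, Fintype.card_fin, nsmul_eq_mul]
    ring
  rw [hsplit, varpi]
  exact add_le_add_right (inv_sub_one_sq_le hpos hsum l) _

/-- The inexactness of the averaged iteration: `ownResidual` minus `F(x̄) - x̄`. -/
noncomputable def residualError (A : Matrix (Fin N) (Fin N) ℝ) (w : Fin N → ℝ)
    (F : ∀ i, PiLp 2 H → H i) (X : Fin N → PiLp 2 H) : PiLp 2 H :=
  ownResidual A F X - (blockOperator F (weightedMean w X) - weightedMean w X)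

omit [∀ i, InnerProductSpace ℝ (H i)] in
theorem norm_diagonal_le_naturalNorm (Z : Fin N → PiLp 2 H) :
    ‖(WithLp.toLp 2 fun l => Z l l : PiLp 2 H)‖ ≤ naturalNorm Z := by
  rw [PiLp.norm_eq_of_L2, naturalNorm]
  refine Real.sqrt_le_sqrt (Finset.sum_le_sum fun l _ => ?_)
  exact pow_le_pow_left₀ (norm_nonneg _) (PiLp.norm_apply_le (Z l) l) 2

theorem norm_residualError_le [NeZero N] (hA : A ∈ Matrix.rowStochastic ℝ (Fin N))
    (hw : IsLeftStochasticEigenvector A w) (hpos : ∀ i, 0 < w i)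
    (hρ : weightedOpNorm w (A - onesOuter w) ≤ 1) {L : ℝ} (hL0 : 0 ≤ L)
    (hL : ∀ i x y, ‖F i x - F i y‖ ≤ L * ‖x - y‖) {c₁ : ℝ} (hc₁ : 0 < c₁)
    (hc : ∀ z : Fin N → PiLp 2 H, c₁ * naturalNorm z ≤ weightedNorm w z) (X : Fin N → PiLp 2 H) :
    ‖residualError A w F X‖ ≤ (L + 1) / c₁ * weightedNorm w (deviation w X) := by
  set Z := deviation w X with hZ
  have hnat : ∀ z : Fin N → PiLp 2 H, naturalNorm z ≤ weightedNorm w z / c₁ := fun z => by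
    rw [le_div_iff₀ hc₁, mul_comm]
    exact hc z
  set u : PiLp 2 H := WithLp.toLp 2 fun l => F l (X l) - F l (weightedMean w X) with hu
  set AZ : Fin N → PiLp 2 H := fun i => ∑ j, (A - onesOuter w) i j • Z j with hAZ
  -- The Lipschitz part u yields the L in L + 1, the consensus part the 1.
  have hdec : residualError A w F X = u - WithLp.toLp 2 fun l => AZ l l := by
    ext l
    simp only [residualError, ownResidual, blockOperator, hu, hAZ, hZ,
      sum_sub_onesOuter_smul_deviation hw.2.1, sum_row_smul_deviation hA, PiLp.sub_apply,
      sum_smul_apply]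
    abel
  have hu_le : ‖u‖ ≤ L * naturalNorm Z := by
    refine le_of_sq_le_sq ?_ (mul_nonneg hL0 (Real.sqrt_nonneg _))
    rw [PiLp.norm_sq_eq_of_L2, mul_pow, naturalNorm_sq, Finset.mul_sum]
    refine Finset.sum_le_sum fun l _ => ?_
    rw [← mul_pow]
    exact pow_le_pow_left₀ (norm_nonneg _) (hL l _ _) 2
  have hAZ_le : naturalNorm AZ ≤ weightedNorm w Z / c₁ := by
    refine (hnat AZ).trans (div_le_div_of_nonneg_right ?_ hc₁.le)
    refine (weightedNorm_sum_smul_le hpos _ Z).trans ?_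
    exact mul_le_of_le_one_left (weightedNorm_nonneg _ _) hρ
  calc ‖residualError A w F X‖ ≤ ‖u‖ + naturalNorm AZ := by
        rw [hdec]
        exact (norm_sub_le _ _).trans (add_le_add_right (norm_diagonal_le_naturalNorm AZ) _)
    _ ≤ L * (weightedNorm w Z / c₁) + weightedNorm w Z / c₁ :=
        add_le_add (hu_le.trans (mul_le_mul_of_nonneg_left (hnat Z) hL0)) hAZ_le
    _ = _ := by ring

theorem IsDOPStep.weightedNorm_deviation_le [NeZero N] (h : IsDOPStep A w F α X Y) (hα : 0 ≤ α)
    (hA : A ∈ Matrix.rowStochastic ℝ (Fin N))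
    (hw : IsLeftStochasticEigenvector A w) (hpos : ∀ i, 0 < w i)
    (hρ : weightedOpNorm w (A - onesOuter w) ≤ 1) {L : ℝ} (hL0 : 0 ≤ L)
    (hL : ∀ i x y, ‖F i x - F i y‖ ≤ L * ‖x - y‖)
    (hFix : (Function.fixedPoints (blockOperator F)).Nonempty)
    (hQNE : QuasiNonexpansive (blockOperator F)) {c₁ c₂ : ℝ} (hc₁ : 0 < c₁) (hc₂ : 0 < c₂)
    (hc : ∀ z : Fin N → PiLp 2 H,
      c₁ * naturalNorm z ≤ weightedNorm w z ∧ weightedNorm w z ≤ c₂ * naturalNorm z) :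
    weightedNorm w (deviation w Y) ≤
      (weightedOpNorm w (A - onesOuter w) + α * (2 * c₂ * √(varpi w * (L ^ 2 + 1)) / c₁)) *
        weightedNorm w (deviation w X) +
      2 * α * c₂ * √(2 * varpi w) *
        Metric.infDist (weightedMean w X) (Function.fixedPoints (blockOperator F)) := by
  have hpos0 : ∀ i, 0 ≤ w i := fun i => (hpos i).le
  set Z := weightedNorm w (deviation w X)
  set d := Metric.infDist (weightedMean w X) (Function.fixedPoints (blockOperator F))
  have hZ0 : 0 ≤ Z := weightedNorm_nonneg _ _
  have hd0 : 0 ≤ d := Metric.infDist_nonneg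
  have hL2 : (L + 1) / c₁ ≤ 2 * √(L ^ 2 + 1) / c₁ := by
    refine div_le_div_of_nonneg_right (le_of_sq_le_sq ?_ (by positivity)) hc₁.le
    rw [mul_pow, Real.sq_sqrt (by positivity)]
    nlinarith [sq_nonneg (L - 1)]
  -- The extra √2, like L + 1 ≤ 2√(L² + 1), only loosens the bound to match the entries of Θ.
  have h2 : (1 : ℝ) ≤ √2 := Real.one_le_sqrt.2 one_le_two
  have hg : ‖ownResidual A F X‖ ≤ √2 * (2 * d) + 2 * √(L ^ 2 + 1) / c₁ * Z := by
    have e : ownResidual A F X = (blockOperator F (weightedMean w X) - weightedMean w X) +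
        residualError A w F X := by
      rw [residualError]
      abel
    rw [e]
    refine (norm_add_le _ _).trans (add_le_add ?_ ?_)
    · exact (hQNE.norm_sub_le_two_mul_infDist hFix _).trans
        (le_mul_of_one_le_left (by positivity) h2)
    · exact (norm_residualError_le hA hw hpos hρ hL0 hL hc₁ (fun z => (hc z).1) X).trans
        (mul_le_mul_of_nonneg_right hL2 hZ0)
  have hP : weightedNorm w (ownPerturbation w (ownResidual A F X)) ≤
      c₂ * (√(varpi w) * (√2 * (2 * d) + 2 * √(L ^ 2 + 1) / c₁ * Z)) := by
    refine (hc _).2.trans (mul_le_mul_of_nonneg_left ?_ hc₂.le)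
    exact (naturalNorm_ownPerturbation_le hpos hw.2.1 _).trans
      (mul_le_mul_of_nonneg_left hg (Real.sqrt_nonneg _))
  rw [h.deviation_eq hA hw hpos, Real.sqrt_mul (varpi_nonneg w), Real.sqrt_mul zero_le_two]
  refine (weightedNorm_add_le hpos0 _ _).trans ?_
  rw [weightedNorm_smul hpos0, abs_of_nonneg hα]
  calc _ ≤ weightedOpNorm w (A - onesOuter w) * Z +
        α * (c₂ * (√(varpi w) * (√2 * (2 * d) + 2 * √(L ^ 2 + 1) / c₁ * Z))) :=
        add_le_add (weightedNorm_sum_smul_le hpos _ _) (mul_le_mul_of_nonneg_left hP hα)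
    _ = _ := by ring

theorem IsDOPStep.weightedMean_eq_relaxation (h : IsDOPStep A w F α X Y)
    (hw : IsLeftStochasticEigenvector A w) (hpos : ∀ i, 0 < w i) :
    weightedMean w Y = weightedMean w X +
      α • (blockOperator F (weightedMean w X) - weightedMean w X) +
      α • residualError A w F X := by
  rw [h.weightedMean_eq hw hpos, residualError]
  module

end Iteration

/-! ### Convergence to a common fixed point -/

section Convergence

variable {N : ℕ} {H : Fin N → Type*} [∀ i, NormedAddCommGroup (H i)]
  [∀ i, InnerProductSpace ℝ (H i)] {A : Matrix (Fin N) (Fin N) ℝ} {w : Fin N → ℝ}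
  {F : ∀ i, PiLp 2 H → H i} {α : ℝ} {X Y : Fin N → PiLp 2 H}

omit [∀ i, InnerProductSpace ℝ (H i)] in
theorem continuous_blockOperator (hF : ∀ i, Continuous (F i)) : Continuous (blockOperator F) :=
  (PiLp.continuous_toLp 2 H).comp (continuous_pi hF)

omit [∀ i, InnerProductSpace ℝ (H i)] in
theorem isClosed_fixedPoints_blockOperator (hF : ∀ i, Continuous (F i)) :
    IsClosed (Function.fixedPoints (blockOperator F)) :=
  isClosed_eq (continuous_blockOperator hF) continuous_id

theorem IsDOPStep.infDist_weightedMean_le (h : IsDOPStep A w F α X Y)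
    (hw : IsLeftStochasticEigenvector A w) (hpos : ∀ i, 0 < w i)
    (hFix : (Function.fixedPoints (blockOperator F)).Nonempty)
    (hQNE : QuasiNonexpansive (blockOperator F)) {κ δ : ℝ} (hκ : 0 < κ)
    (hreg : LinearlyRegular (blockOperator F) κ) (hα : 0 < α) (hδ : 0 < δ) (hαδ : α < 1 - δ) :
    Metric.infDist (weightedMean w Y) (Function.fixedPoints (blockOperator F)) ≤
      α * ‖residualError A w F X‖ + (1 - δ * α / (4 * κ ^ 2)) *
        Metric.infDist (weightedMean w X) (Function.fixedPoints (blockOperator F)) := by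
  rw [h.weightedMean_eq_relaxation hw hpos, add_comm (α * _)]
  refine Metric.infDist_le_infDist_add_dist.trans (add_le_add
    (infDist_relaxation_le hQNE hFix hκ hreg hα hδ hαδ _) ?_)
  rw [dist_self_add_left, norm_smul, Real.norm_eq_abs, abs_of_pos hα]

theorem IsDOPStep.dist_weightedMean_le (h : IsDOPStep A w F α X Y)
    (hw : IsLeftStochasticEigenvector A w) (hpos : ∀ i, 0 < w i)
    (hFix : (Function.fixedPoints (blockOperator F)).Nonempty)
    (hQNE : QuasiNonexpansive (blockOperator F)) (hα : 0 ≤ α) :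
    dist (weightedMean w X) (weightedMean w Y) ≤ α * ‖residualError A w F X‖ +
      2 * α * Metric.infDist (weightedMean w X) (Function.fixedPoints (blockOperator F)) := by
  rw [h.weightedMean_eq_relaxation hw hpos, add_assoc, dist_self_add_right, ← smul_add, norm_smul,
    Real.norm_eq_abs, abs_of_nonneg hα]
  have h1 := hQNE.norm_sub_le_two_mul_infDist hFix (weightedMean w X)
  have h2 := norm_add_le (blockOperator F (weightedMean w X) - weightedMean w X)
    (residualError A w F X)
  nlinarith

/-- If both the deviations from the average and the distance of the average to the fixed point set
decay geometrically, then all estimates converge to a common fixed point. -/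
theorem exists_fixedPoint_of_geometric_decay [∀ i, CompleteSpace (H i)]
    (hF : ∀ i, Continuous (F i))
    (hFix : (Function.fixedPoints (blockOperator F)).Nonempty) {x : ℕ → Fin N → PiLp 2 H}
    {r C D E : ℝ} (hr : r ∈ Set.Ioo (0 : ℝ) 1)
    (hdev : ∀ k i, ‖deviation w (x k) i‖ ≤ C * r ^ k)
    (hdist : ∀ k, Metric.infDist (weightedMean w (x k)) (Function.fixedPoints (blockOperator F)) ≤
      D * r ^ k)
    (hstep : ∀ k, dist (weightedMean w (x k)) (weightedMean w (x (k + 1))) ≤ E * r ^ k) :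
    ∃ xstar ∈ Function.fixedPoints (blockOperator F), ∃ C' : ℝ,
      ∀ k i, ‖x k i - xstar‖ ≤ C' * r ^ k := by
  obtain ⟨y, hy⟩ := cauchySeq_tendsto_of_complete (cauchySeq_of_le_geometric r E hr.2 hstep)
  have hzero : Metric.infDist y (Function.fixedPoints (blockOperator F)) = 0 := by
    have h1 := ((Metric.continuous_infDist_pt (Function.fixedPoints (blockOperator F))).tendsto
      y).comp hy
    have h2 : Filter.Tendsto (fun k : ℕ => D * r ^ k) Filter.atTop (nhds 0) := by
      simpa using (tendsto_pow_atTop_nhds_zero_of_lt_one hr.1.le hr.2).const_mul D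
    exact le_antisymm (le_of_tendsto_of_tendsto' h1 h2 hdist) Metric.infDist_nonneg
  refine ⟨y, ((isClosed_fixedPoints_blockOperator hF).mem_iff_infDist_zero hFix).2 hzero,
    C + E / (1 - r), fun k i => ?_⟩
  have h1 := dist_le_of_le_geometric_of_tendsto r E hr.2 hstep hy k
  rw [dist_eq_norm] at h1
  calc ‖x k i - y‖ = ‖deviation w (x k) i + (weightedMean w (x k) - y)‖ := by
        rw [deviation]
        congr 1
        abel
    _ ≤ C * r ^ k + E * r ^ k / (1 - r) := (norm_add_le _ _).trans (add_le_add (hdev k i) h1)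
    _ = _ := by ring

end Convergence

/-! ### The determinant and its smallest positive root -/

section Roots

variable {N : ℕ} {A : Matrix (Fin N) (Fin N) ℝ} {w L : Fin N → ℝ} {c₁ c₂ δ κ : ℝ}

/-- The coefficient of `-α²` in `det (I - Θ(α))`. -/
noncomputable def detCoeff {N : ℕ} (w L : Fin N → ℝ) (c₁ c₂ δ κ : ℝ) : ℝ :=
  2 * c₂ * √(varpi w * ((⨆ i, L i) ^ 2 + 1)) / c₁ * (δ / (4 * κ ^ 2)) +
    2 * c₂ * √(2 * varpi w) * (((⨆ i, L i) + 1) / c₁)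

theorem det_one_sub_Theta (A : Matrix (Fin N) (Fin N) ℝ) (w L : Fin N → ℝ) (c₁ c₂ δ κ a : ℝ) :
    (1 - Theta A w L c₁ c₂ δ κ a).det =
      a * ((1 - weightedOpNorm w (A - onesOuter w)) * (δ / (4 * κ ^ 2)) -
        a * detCoeff w L c₁ c₂ δ κ) := by
  rw [Matrix.det_fin_two]
  simp [Theta, detCoeff]
  ring

theorem isLeast_positiveRoots (hρ : weightedOpNorm w (A - onesOuter w) < 1) (hδ : 0 < δ)
    (hκ : 0 < κ) (hden : 0 < detCoeff w L c₁ c₂ δ κ) :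
    IsLeast (positiveRoots A w L c₁ c₂ δ κ)
      ((1 - weightedOpNorm w (A - onesOuter w)) * (δ / (4 * κ ^ 2)) /
        detCoeff w L c₁ c₂ δ κ) := by
  have hnum : 0 < (1 - weightedOpNorm w (A - onesOuter w)) * (δ / (4 * κ ^ 2)) :=
    mul_pos (sub_pos.2 hρ) (by positivity)
  refine ⟨⟨div_pos hnum hden, ?_⟩, ?_⟩
  · rw [det_one_sub_Theta, div_mul_cancel₀ _ hden.ne', sub_self, mul_zero]
  · rintro a ⟨ha, hroot⟩
    rw [det_one_sub_Theta] at hroot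
    have := (mul_eq_zero.1 hroot).resolve_left ha.ne'
    rw [div_le_iff₀ hden]
    linarith

theorem mul_detCoeff_lt (hρ : weightedOpNorm w (A - onesOuter w) < 1) (hδ : 0 < δ)
    (hκ : 0 < κ) (hden : 0 ≤ detCoeff w L c₁ c₂ δ κ) {α : ℝ}
    (h : ∀ αL, IsLeast (positiveRoots A w L c₁ c₂ δ κ) αL → α < αL) :
    α * detCoeff w L c₁ c₂ δ κ <
      (1 - weightedOpNorm w (A - onesOuter w)) * (δ / (4 * κ ^ 2)) := by
  -- With zero coefficient, as for N = 1 where ϖ = 0, there is no root and the inequality is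
  -- automatic.
  rcases hden.eq_or_lt with h0 | hden
  · rw [← h0, mul_zero]
    exact mul_pos (sub_pos.2 hρ) (by positivity)
  · exact (lt_div_iff₀ hden).1 (h _ (isLeast_positiveRoots hρ hδ hκ hden))

end Roots

end DOP

/-! ### The main theorem -/

theorem theorem2 {N : ℕ} [NeZero N] {H : Fin N → Type*}
    [∀ i, NormedAddCommGroup (H i)] [∀ i, InnerProductSpace ℝ (H i)] [∀ i, CompleteSpace (H i)]
    -- the communication graph, its weight matrix, and the Perron vector of the latter
    (G : Digraph (Fin N)) (hG : DOP.StronglyConnected G)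
    (A : Matrix (Fin N) (Fin N) ℝ) (hA : A ∈ Matrix.rowStochastic ℝ (Fin N))
    (hAG : DOP.CompatibleWith A G)
    (w : Fin N → ℝ) (hw : DOP.IsLeftStochasticEigenvector A w)
    -- the local operators and the global operator
    (F : ∀ i, PiLp 2 H → H i)
    (L : Fin N → NNReal) (hL : ∀ i, LipschitzWith (L i) (F i))
    (hFix : (Function.fixedPoints (DOP.blockOperator F)).Nonempty)
    (hQNE : DOP.QuasiNonexpansive (DOP.blockOperator F))
    (κ : ℝ) (hκ : 0 < κ) (hreg : DOP.LinearlyRegular (DOP.blockOperator F) κ)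
    -- norm equivalence constants
    (c₁ c₂ : ℝ) (hc₁ : 0 < c₁) (hc₂ : 0 < c₂)
    (hc : ∀ z : Fin N → PiLp 2 H,
      c₁ * DOP.naturalNorm z ≤ DOP.weightedNorm w z ∧
        DOP.weightedNorm w z ≤ c₂ * DOP.naturalNorm z)
    (δ : ℝ) (hδ : δ ∈ Set.Ioo (0 : ℝ) 1) :
    -- with at least two agents, the smallest positive root exists
    (2 ≤ N → ∃ αL, IsLeast (DOP.positiveRoots A w (fun i => (L i : ℝ)) c₁ c₂ δ κ) αL) ∧
    -- for a single agent there is no positive root, and the bound on `α` is `1 - δ` alone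
    ∀ α : ℝ, 0 < α → α < 1 - δ →
      (∀ αL, IsLeast (DOP.positiveRoots A w (fun i => (L i : ℝ)) c₁ c₂ δ κ) αL → α < αL) →
      ∃ r ∈ Set.Ioo (0 : ℝ) 1, ∀ x : ℕ → Fin N → PiLp 2 H,
        DOP.IsDOPSequence A w F α x →
          ∃ xstar ∈ Function.fixedPoints (DOP.blockOperator F), ∃ C : ℝ,
            ∀ k i, ‖x k i - xstar‖ ≤ C * r ^ k := by
  have hpos := hw.pos hG hA hAG
  have hρ := DOP.weightedOpNorm_sub_onesOuter_lt_one hG hA hAG hw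
  have hρ0 := DOP.weightedOpNorm_nonneg w (A - DOP.onesOuter w)
  have hϖ := DOP.varpi_nonneg w
  have hLle : ∀ i, (L i : ℝ) ≤ ⨆ i, (L i : ℝ) := fun i =>
    le_ciSup (f := fun i => (L i : ℝ)) (Set.finite_range _).bddAbove i
  have hL0 : 0 ≤ ⨆ i, (L i : ℝ) := Real.iSup_nonneg fun i => (L i).2
  have hFL : ∀ i x y, ‖F i x - F i y‖ ≤ (⨆ i, (L i : ℝ)) * ‖x - y‖ := fun i x y =>
    ((hL i).norm_sub_le x y).trans (mul_le_mul_of_nonneg_right (hLle i) (norm_nonneg _))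
  obtain ⟨hδ0, -⟩ := hδ
  refine ⟨fun hN => ⟨_, DOP.isLeast_positiveRoots hρ hδ0 hκ ?_⟩, fun α hα hαδ hroot => ?_⟩
  · have := DOP.varpi_pos hN w
    exact add_pos (by positivity) (by positivity)
  have hden : 0 ≤ DOP.detCoeff w (fun i => (L i : ℝ)) c₁ c₂ δ κ :=
    add_nonneg (by positivity) (by positivity)
  have hdet := DOP.mul_detCoeff_lt hρ hδ0 hκ hden hroot
  unfold DOP.detCoeff at hdet
  set ρ := DOP.weightedOpNorm w (A - DOP.onesOuter w)
  set Lbar := ⨆ i, (L i : ℝ)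
  set fix := Function.fixedPoints (DOP.blockOperator F)
  have hσ : 0 < δ * α / (4 * κ ^ 2) := by positivity
  -- The rate depends only on the entries of Θ(α), hence is uniform in the initial points; α times
  -- `hdet` is the determinant condition.
  obtain ⟨r, hr, hrate⟩ := DOP.exists_rate_of_two_by_two
    (p := ρ + α * (2 * c₂ * √(DOP.varpi w * (Lbar ^ 2 + 1)) / c₁))
    (q := 2 * α * c₂ * √(2 * DOP.varpi w)) (s := α * ((Lbar + 1) / c₁))
    (m := 1 - δ * α / (4 * κ ^ 2)) (by positivity) (by positivity) (by positivity) (by linarith) (by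
      have e : δ * α / (4 * κ ^ 2) = δ / (4 * κ ^ 2) * α := by ring
      rw [e]
      nlinarith [mul_lt_mul_of_pos_left hdet hα])
  refine ⟨r, hr, fun x hx => ?_⟩
  have herr : ∀ k, ‖DOP.residualError A w F (x k)‖ ≤
      (Lbar + 1) / c₁ * DOP.weightedNorm w (DOP.deviation w (x k)) := fun k =>
    DOP.norm_residualError_le hA hw hpos hρ.le hL0 hFL hc₁ (fun z => (hc z).1) (x k)
  obtain ⟨C, hC, hdecay⟩ := hrate (fun k => DOP.weightedNorm w (DOP.deviation w (x k)))
    (fun k => Metric.infDist (DOP.weightedMean w (x k)) fix)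
    (fun k => DOP.weightedNorm_nonneg _ _) (fun k => Metric.infDist_nonneg)
    (fun k => by
      refine or_iff_not_imp_left.2 fun h => ?_
      have h1 := DOP.regularity_gap_le_one hQNE hFix hκ hreg hα hδ0 hαδ h
      have e : δ * α / (4 * κ ^ 2) = δ * α / κ ^ 2 / 4 := by field_simp
      linarith)
    (fun k => (hx.step k).weightedNorm_deviation_le hα.le hA hw hpos hρ.le hL0 hFL hFix hQNE
      hc₁ hc₂ hc)
    (fun k => by
      refine ((hx.step k).infDist_weightedMean_le hw hpos hFix hQNE hκ hreg hα hδ0 hαδ).trans ?_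
      rw [mul_assoc α]
      exact add_le_add_left (mul_le_mul_of_nonneg_left (herr k) hα.le) _)
  refine DOP.exists_fixedPoint_of_geometric_decay (w := w) (C := C / c₁) (D := C)
    (E := α * ((Lbar + 1) / c₁) * C + 2 * α * C) (fun i => (hL i).continuous) hFix hr
    (fun k i => ?_) (fun k => (hdecay k).2) (fun k => ?_)
  · refine (DOP.norm_le_naturalNorm _ i).trans ?_
    rw [div_mul_eq_mul_div, le_div_iff₀ hc₁, mul_comm]
    exact (hc _).1.trans (hdecay k).1
  · refine ((hx.step k).dist_weightedMean_le hw hpos hFix hQNE hα.le).trans ?_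
    calc _ ≤ α * ((Lbar + 1) / c₁ * (C * r ^ k)) + 2 * α * (C * r ^ k) := by
          refine add_le_add (mul_le_mul_of_nonneg_left ((herr k).trans ?_) hα.le)
            (mul_le_mul_of_nonneg_left (hdecay k).2 (by positivity))
          exact mul_le_mul_of_nonneg_left (hdecay k).1 (by positivity)
      _ = _ := by ring
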